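/- All von Neumann algebras act on complex Hilbert spaces, and an inclusion $M\subset\mathcal M$ of von Neumann algebras means that $M$ is a von Neumann subalgebra of the von Neumann algebra $\mathcal M\subset B(H)$ with the same unit. Let $\mathscr P$ be a property of inclusions of von Neumann algebras such that: (a) if $M\subset\mathcal M$ has $\mathscr P$, then for every (self-adjoint) projection $q\in M$ the inclusion $qMq\subset q\mathcal Mq$ (of von Neumann algebras with unit $q$, acting on $qH$) has $\mathscr P$; (b) if $M\subset\mathcal M$ has $\mathscr P$ and $\pi:\mathcal M\to\mathcal M^1$ is a $*$-isomorphism onto a von Neumann algebra $\mathcal M^1$ (possibly on another Hilbert space) taking $M$ onto a von Neumann subalgebra $M^1\subset\mathcal M^1$, then $M^1\subset\mathcal M^1$ has $\mathscr P$. Suppose that for every inclusion $M\subset\mathcal M$ with property $\mathscr P$ such that $M$ is $\sigma$-finite (every set of pairwise orthogonal nonzero projections in $M$ is countable) there is a completely contractive linear projection $P:\mathcal M\to M$, i.e. a linear map with $P(x)=x$ for all $x\in M$ such that, for every $n$, the map $[x_{ij}]\mapsto[P(x_{ij})]$ from $M_n(\mathcal M)\subset B(H^n)$ to $M_n(M)\subset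 B(H^n)$ has norm at most $1$. Then for every inclusion $M\subset\mathcal M$ with property $\mathscr P$ there is a completely contractive linear projection $P:\mathcal M\to M$. -/

import Mathlib

universe u v

noncomputable section

/-- The orthogonal projections of a complex Hilbert space, as self-adjoint idempotent operators. -/
structure HilbertProjection (H : Type u) [NormedAddCommGroup H] [InnerProductSpace ℂ H]
    [CompleteSpace H] where
  /-- the projection, as a bounded operator -/
  op : H →L[ℂ] H
  isStarProjection : IsStarProjection op

namespace HilbertProjection

variable {H : Type u} [NormedAddCommGroup H] [InnerProductSpace ℂ H] [CompleteSpace H]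

/-- The range `qH` of a projection `q`; it is the Hilbert space on which corners by `q` act. -/
def space (q : HilbertProjection H) : Submodule ℂ H := LinearMap.range (q.op : H →ₗ[ℂ] H)

theorem mem_space_iff (q : HilbertProjection H) (x : H) : x ∈ q.space ↔ q.op x = x := by
  constructor
  · rintro ⟨y, rfl⟩
    have h := congrArg (fun T : H →L[ℂ] H => T y) q.isStarProjection.isIdempotentElem.eq
    simpa using h
  · intro h
    exact ⟨x, h⟩

theorem isClosed_space (q : HilbertProjection H) : IsClosed (q.space : Set H) := by
  have h : (q.space : Set H) = {x | q.op x = x} := by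
    ext x
    exact q.mem_space_iff x
  rw [h]
  exact isClosed_eq q.op.continuous continuous_id

instance instCompleteSpaceSpace (q : HilbertProjection H) : CompleteSpace q.space :=
  q.isClosed_space.completeSpace_coe

/-- The inclusion `qH → H`. -/
def incl (q : HilbertProjection H) : q.space →L[ℂ] H := q.space.subtypeL

/-- The operator `q`, seen as a map `H → qH`. -/
def proj (q : HilbertProjection H) : H →L[ℂ] q.space :=
  q.op.codRestrict q.space fun x => ⟨x, rfl⟩

theorem incl_proj (q : HilbertProjection H) (x : H) : q.incl (q.proj x) = q.op x := rfl

theorem proj_incl (q : HilbertProjection H) (x : q.space) : q.proj (q.incl x) = x :=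
  Subtype.ext ((q.mem_space_iff x).1 x.2)

theorem adjoint_incl (q : HilbertProjection H) : ContinuousLinearMap.adjoint q.incl = q.proj := by
  symm
  rw [ContinuousLinearMap.eq_adjoint_iff]
  intro x y
  have hsa : ContinuousLinearMap.adjoint q.op = q.op := q.isStarProjection.isSelfAdjoint.star_eq
  have hy : q.op (y : H) = y := (q.mem_space_iff y).1 y.2
  change inner ℂ (q.op x) (y : H) = inner ℂ x (y : H)
  rw [← hsa, ContinuousLinearMap.adjoint_inner_left, hy]

theorem adjoint_proj (q : HilbertProjection H) : ContinuousLinearMap.adjoint q.proj = q.incl := by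
  rw [← q.adjoint_incl, ContinuousLinearMap.adjoint_adjoint]

/-- The operator `q x q`, restricted to an operator on `qH`. -/
def compress (q : HilbertProjection H) (x : H →L[ℂ] H) : q.space →L[ℂ] q.space :=
  q.proj ∘L x ∘L q.incl

/-- An operator on `qH`, extended by zero to an operator `x` on `H` with `x = q x q`. -/
def extend (q : HilbertProjection H) (T : q.space →L[ℂ] q.space) : H →L[ℂ] H :=
  q.incl ∘L T ∘L q.proj

theorem compress_extend (q : HilbertProjection H) (T : q.space →L[ℂ] q.space) :
    q.compress (q.extend T) = T := by
  ext x
  simp [compress, extend, proj_incl]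

theorem extend_compress (q : HilbertProjection H) (x : H →L[ℂ] H) :
    q.extend (q.compress x) = q.op * x * q.op := by
  ext y
  simp [compress, extend, incl_proj]

theorem extend_mul (q : HilbertProjection H) (S T : q.space →L[ℂ] q.space) :
    q.extend (S * T) = q.extend S * q.extend T := by
  ext x
  simp [extend, proj_incl]

theorem extend_add (q : HilbertProjection H) (S T : q.space →L[ℂ] q.space) :
    q.extend (S + T) = q.extend S + q.extend T := by
  ext x
  simp [extend]

theorem extend_algebraMap (q : HilbertProjection H) (c : ℂ) :
    q.extend (algebraMap ℂ (q.space →L[ℂ] q.space) c) = c • q.op := by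
  ext x
  simp [extend, incl_proj, Algebra.algebraMap_eq_smul_one]

theorem extend_star (q : HilbertProjection H) (T : q.space →L[ℂ] q.space) :
    q.extend (star T) = star (q.extend T) := by
  simp only [extend, ContinuousLinearMap.star_eq_adjoint, ContinuousLinearMap.adjoint_comp,
    adjoint_incl, adjoint_proj]
  rfl

end HilbertProjection

namespace VonNeumannAlgebra

variable {H : Type u} [NormedAddCommGroup H] [InnerProductSpace ℂ H] [CompleteSpace H]

/-- A von Neumann algebra is `σ`-finite (countably decomposable) if every set of pairwise
orthogonal nonzero projections in it is countable. -/
def IsSigmaFinite (M : VonNeumannAlgebra H) : Prop :=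
  ∀ S : Set (H →L[ℂ] H), (∀ p ∈ S, p ∈ M ∧ IsStarProjection p ∧ p ≠ 0) →
    S.Pairwise (fun p p' => p * p' = 0) → S.Countable

/-- The operators `T` on `qH` whose extension by zero to `H` lies in `M`. -/
def cornerStarSubalgebra (M : VonNeumannAlgebra H) (q : HilbertProjection H) (hq : q.op ∈ M) :
    StarSubalgebra ℂ (q.space →L[ℂ] q.space) where
  carrier := {T | q.extend T ∈ M}
  mul_mem' {S T} hS hT := by
    change q.extend (S * T) ∈ M
    rw [q.extend_mul]
    exact mul_mem hS hT
  add_mem' {S T} hS hT := by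
    change q.extend (S + T) ∈ M
    rw [q.extend_add]
    exact add_mem hS hT
  algebraMap_mem' c := by
    change q.extend (algebraMap ℂ _ c) ∈ M
    rw [q.extend_algebraMap]
    exact M.toStarSubalgebra.smul_mem hq c
  star_mem' {T} hT := by
    change q.extend (star T) ∈ M
    rw [q.extend_star]
    exact star_mem hT

/-- The corner `qMq`, for a projection `q ∈ M`, as a von Neumann algebra on `qH` with unit `q`. -/
def corner (M : VonNeumannAlgebra H) (q : HilbertProjection H) (hq : q.op ∈ M) :
    VonNeumannAlgebra q.space where
  toStarSubalgebra := M.cornerStarSubalgebra q hq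
  centralizer_centralizer' := by
    refine Set.Subset.antisymm ?_ Set.subset_centralizer_centralizer
    intro T hT
    change q.extend T ∈ M
    rw [← M.commutant_commutant, mem_commutant_iff]
    intro y hy
    rw [mem_commutant_iff] at hy
    have hyq : ∀ x : H, q.op (y x) = y (q.op x) := fun x =>
      congrArg (fun R : H →L[ℂ] H => R x) (hy q.op hq)
    have hyi : ∀ x : q.space, q.incl (q.compress y x) = y (q.incl x) := by
      intro x
      have hx : q.op (q.incl x) = q.incl x := (q.mem_space_iff x).1 x.2
      calc q.incl (q.compress y x) = q.op (y (q.incl x)) := rfl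
        _ = y (q.incl x) := by rw [hyq, hx]
    have hyp : ∀ x : H, q.proj (y x) = q.compress y (q.proj x) := by
      intro x
      apply Subtype.ext
      change q.incl (q.proj (y x)) = q.incl (q.compress y (q.proj x))
      rw [hyi, q.incl_proj, q.incl_proj, hyq]
    have hcomm : q.compress y * T = T * q.compress y := by
      refine hT (q.compress y) ?_
      intro S hS
      have hSM : q.extend S ∈ M := hS
      have h1 := congrArg q.compress (hy _ hSM)
      have h2 : q.compress (q.extend S * y) = S * q.compress y := by
        ext x
        simp [HilbertProjection.compress, HilbertProjection.extend, q.proj_incl]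
      have h3 : q.compress (y * q.extend S) = q.compress y * S := by
        ext x
        simp [HilbertProjection.compress, HilbertProjection.extend, q.proj_incl]
      rw [h2, h3] at h1
      exact h1
    ext x
    have h := congrArg (fun R : q.space →L[ℂ] q.space => q.incl (R (q.proj x))) hcomm
    change y (q.incl (T (q.proj x))) = q.incl (T (q.proj (y x)))
    rw [hyp, ← hyi]
    exact h

theorem mem_corner_iff_extend (M : VonNeumannAlgebra H) (q : HilbertProjection H) (hq : q.op ∈ M)
    (T : q.space →L[ℂ] q.space) : T ∈ M.corner q hq ↔ q.extend T ∈ M := Iff.rfl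

/-- The corner consists exactly of the operators `q x q` with `x ∈ M`, restricted to `qH`. -/
theorem mem_corner_iff (M : VonNeumannAlgebra H) (q : HilbertProjection H) (hq : q.op ∈ M)
    (T : q.space →L[ℂ] q.space) : T ∈ M.corner q hq ↔ ∃ x ∈ M, q.compress x = T := by
  rw [mem_corner_iff_extend]
  constructor
  · intro h
    exact ⟨_, h, q.compress_extend T⟩
  · rintro ⟨x, hx, rfl⟩
    rw [q.extend_compress]
    exact mul_mem (mul_mem hq hx) hq

end VonNeumannAlgebra

/-- The operator on `Hⁿ` (the Hilbert space direct sum of `n` copies of `H`) given by an `n × n`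
matrix of bounded operators on `H`. -/
def matrixOperator {H : Type u} [NormedAddCommGroup H] [InnerProductSpace ℂ H] {n : ℕ}
    (x : Matrix (Fin n) (Fin n) (H →L[ℂ] H)) :
    PiLp 2 (fun _ : Fin n => H) →L[ℂ] PiLp 2 (fun _ : Fin n => H) :=
  ((PiLp.continuousLinearEquiv 2 ℂ (fun _ : Fin n => H)).symm :
      (Fin n → H) →L[ℂ] PiLp 2 (fun _ : Fin n => H)) ∘L
    ContinuousLinearMap.pi fun i => ∑ j, x i j ∘L PiLp.proj 2 (fun _ : Fin n => H) j

theorem matrixOperator_apply {H : Type u} [NormedAddCommGroup H] [InnerProductSpace ℂ H] {n : ℕ}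
    (x : Matrix (Fin n) (Fin n) (H →L[ℂ] H)) (ξ : PiLp 2 (fun _ : Fin n => H)) (i : Fin n) :
    matrixOperator x ξ i = ∑ j, x i j (ξ j) := by
  simp [matrixOperator]

/-- A linear map `φ : A → B` between *-algebras of operators is completely contractive if, for every
`n`, the map `[x i j] ↦ [φ (x i j)]` from `Mₙ(A)` to `Mₙ(B)` is contractive, where `Mₙ(A)` and
`Mₙ(B)` carry the operator norms of `Mₙ(B(H)) = B(Hⁿ)` and `Mₙ(B(K)) = B(Kⁿ)`. -/
def IsCompletelyContractive {H : Type u} [NormedAddCommGroup H] [InnerProductSpace ℂ H]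
    [CompleteSpace H] {K : Type v} [NormedAddCommGroup K] [InnerProductSpace ℂ K] [CompleteSpace K]
    {A : StarSubalgebra ℂ (H →L[ℂ] H)} {B : StarSubalgebra ℂ (K →L[ℂ] K)} (φ : A →ₗ[ℂ] B) : Prop :=
  ∀ (n : ℕ) (x : Matrix (Fin n) (Fin n) A),
    ‖matrixOperator (Matrix.of fun i j => (φ (x i j) : K →L[ℂ] K))‖ ≤
      ‖matrixOperator (Matrix.of fun i j => (x i j : H →L[ℂ] H))‖

/-- An inclusion `small ⊆ big` of von Neumann algebras (with common unit) on a Hilbert space. -/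
structure VNInclusion where
  /-- the Hilbert space on which both algebras act -/
  H : Type u
  [instNormedAddCommGroup : NormedAddCommGroup H]
  [instInnerProductSpace : InnerProductSpace ℂ H]
  [instCompleteSpace : CompleteSpace H]
  /-- the smaller algebra -/
  small : VonNeumannAlgebra H
  /-- the larger algebra -/
  big : VonNeumannAlgebra H
  le : small ≤ big

namespace VNInclusion

attribute [instance] instNormedAddCommGroup instInnerProductSpace instCompleteSpace

/-- The inclusion `qMq ⊆ q𝓜q` obtained from `M ⊆ 𝓜` and a projection `q ∈ M`. -/
def corner (I : VNInclusion.{u}) (q : HilbertProjection I.H) (hq : q.op ∈ I.small) :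
    VNInclusion.{u} where
  H := q.space
  small := I.small.corner q hq
  big := I.big.corner q (I.le hq)
  le := fun _ hT => I.le hT

/-- Two inclusions `M ⊆ 𝓜` and `M¹ ⊆ 𝓜¹` are isomorphic if there is a *-isomorphism `𝓜 → 𝓜¹`
taking `M` onto `M¹` (*-isomorphisms of von Neumann algebras are automatically normal). -/
def Isomorphic (I J : VNInclusion.{u}) : Prop :=
  ∃ π : I.big.toStarSubalgebra ≃⋆ₐ[ℂ] J.big.toStarSubalgebra,
    ∀ x : I.big.toStarSubalgebra,
      (π x : J.H →L[ℂ] J.H) ∈ J.small ↔ (x : I.H →L[ℂ] I.H) ∈ I.small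

/-- There is a completely contractive linear projection of `big` onto `small`. -/
def HasCompletelyContractiveProjection (I : VNInclusion.{u}) : Prop :=
  ∃ P : I.big.toStarSubalgebra →ₗ[ℂ] I.small.toStarSubalgebra,
    (∀ x : I.big.toStarSubalgebra, (x : I.H →L[ℂ] I.H) ∈ I.small →
      (P x : I.H →L[ℂ] I.H) = x) ∧
    IsCompletelyContractive P

end VNInclusion

end

/-! Write `M` for the small algebra and `𝓜` for the big one. For a finite set `D` of vectors, the
closed span of `M' D` is `M'`-invariant, so its projection `q` lies in `M`. An element of `qMq` that
kills `D` kills `M' D`, hence all of `qH`; so `D` separates `qMq`, which is therefore `σ`-finite by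
Bessel's inequality. Thus the corner has a completely contractive projection `P_D`, and `T_D x = P_D
(q x q)`, extended by zero, is a complete contraction from `𝓜` into `M`.

These maps converge pointwise weakly along an ultrafilter refining the order on finite sets. The
limit stays in `M`, which is weakly closed, and stays completely contractive, because norms on
`B(Hⁿ)` are weakly lower semicontinuous. For `x ∈ M`, `⟨T_D x v, w⟩ = ⟨q x q v, w⟩ = ⟨x v, w⟩` as
soon as `D` contains `v` and `w`, so the limit fixes `x`. -/

section WeaklyConvergentProjections

open Filter Topology

/-! ### Weak limits of operators and of operator matrices -/

section WeakLimits

variable {H : Type*} [NormedAddCommGroup H] [InnerProductSpace ℂ H]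

/-- A uniformly bounded family of operators converges weakly along every ultrafilter. -/
theorem exists_tendsto_inner_of_bounded [CompleteSpace H] {ι : Type*} (U : Ultrafilter ι)
    (T : ι → H →L[ℂ] H) (C : ℝ) (hT : ∀ i v w, ‖inner ℂ (T i v) w‖ ≤ C * ‖v‖ * ‖w‖) :
    ∃ S : H →L[ℂ] H, ∀ v w,
      Tendsto (fun i => inner ℂ (T i v) w) U (𝓝 (inner ℂ (S v) w)) := by
  have hlim : ∀ v w, ∃ z ∈ Metric.closedBall (0 : ℂ) (C * ‖v‖ * ‖w‖),
      Tendsto (fun i => inner ℂ (T i v) w) U (𝓝 z) := fun v w =>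
    (isCompact_closedBall (0 : ℂ) (C * ‖v‖ * ‖w‖)).ultrafilter_le_nhds
      (U.map fun i => inner ℂ (T i v) w)
      (le_principal_iff.2 (mem_map.2 (Eventually.of_forall fun i => by simpa using hT i v w)))
  choose b hb hlim using hlim
  have hadd₁ : ∀ v v' w, b (v + v') w = b v w + b v' w := fun v v' w =>
    tendsto_nhds_unique (hlim _ _) (by
      simpa only [map_add, inner_add_left] using (hlim v w).add (hlim v' w))
  have hsmul₁ : ∀ (c : ℂ) v w, b (c • v) w = starRingEnd ℂ c * b v w := fun c v w =>
    tendsto_nhds_unique (hlim _ _) (by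
      simpa only [map_smul, inner_smul_left] using (hlim v w).const_mul (starRingEnd ℂ c))
  have hadd₂ : ∀ v w w', b v (w + w') = b v w + b v w' := fun v w w' =>
    tendsto_nhds_unique (hlim _ _) (by
      simpa only [inner_add_right] using (hlim v w).add (hlim v w'))
  have hsmul₂ : ∀ (c : ℂ) v w, b v (c • w) = c * b v w := fun c v w =>
    tendsto_nhds_unique (hlim _ _) (by
      simpa only [inner_smul_right] using (hlim v w).const_mul c)
  -- The limits form a bounded sesquilinear form, represented by an operator via Fréchet–Riesz.
  let B : H →L⋆[ℂ] H →L[ℂ] ℂ :=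
    (LinearMap.mk₂'ₛₗ (starRingEnd ℂ) (RingHom.id ℂ) b hadd₁ hsmul₁ hadd₂ hsmul₂).mkContinuous₂ C
      fun v w => by simpa using hb v w
  refine ⟨InnerProductSpace.continuousLinearMapOfBilin B, fun v w => ?_⟩
  rw [InnerProductSpace.continuousLinearMapOfBilin_apply]
  exact hlim v w

theorem inner_matrixOperator {n : ℕ} (x : Matrix (Fin n) (Fin n) (H →L[ℂ] H))
    (ξ η : PiLp 2 (fun _ : Fin n => H)) :
    inner ℂ (matrixOperator x ξ) η = ∑ i, ∑ j, inner ℂ (x i j (ξ j)) (η i) := by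
  simp [PiLp.inner_apply, matrixOperator_apply, sum_inner]

/-- Level `n = 1` of complete contractivity: it supplies the uniform bound needed for weak limits to
exist. -/
theorem norm_inner_apply_le_matrixOperator (x : H →L[ℂ] H) (v w : H) :
    ‖inner ℂ (x v) w‖ ≤ ‖matrixOperator (Matrix.of fun _ _ : Fin 1 => x)‖ * ‖v‖ * ‖w‖ := by
  have h := norm_inner_le_norm (𝕜 := ℂ)
    (matrixOperator (Matrix.of fun _ _ : Fin 1 => x) (WithLp.toLp 2 fun _ => v))
    (WithLp.toLp 2 fun _ : Fin 1 => w)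
  rw [inner_matrixOperator] at h
  have hn : ∀ u : H, ‖(WithLp.toLp 2 fun _ : Fin 1 => u : PiLp 2 (fun _ : Fin 1 => H))‖ = ‖u‖ :=
    fun u => by simp [PiLp.norm_eq_of_L2]
  have h' := ContinuousLinearMap.le_opNorm (matrixOperator (Matrix.of fun _ _ : Fin 1 => x))
    (WithLp.toLp 2 fun _ : Fin 1 => v)
  rw [hn] at h h'
  simp only [Finset.univ_unique, Finset.sum_singleton, Matrix.of_apply] at h
  exact h.trans (mul_le_mul_of_nonneg_right h' (norm_nonneg w))

/-- Coefficients on `Hⁿ` are finite sums of coefficients of entries, so entrywise weak convergence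
is weak convergence on `Hⁿ`, where closed balls are weakly closed. -/
theorem norm_matrixOperator_le_of_tendsto {ι : Type*} {l : Filter ι} [l.NeBot] {n : ℕ} {C : ℝ}
    (x : ι → Matrix (Fin n) (Fin n) (H →L[ℂ] H)) (y : Matrix (Fin n) (Fin n) (H →L[ℂ] H))
    (hx : ∀ k, ‖matrixOperator (x k)‖ ≤ C)
    (hxy : ∀ i j v w, Tendsto (fun k => inner ℂ (x k i j v) w) l (𝓝 (inner ℂ (y i j v) w))) :
    ‖matrixOperator y‖ ≤ C := by
  obtain ⟨k₀⟩ := l.nonempty_of_neBot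
  refine ContinuousLinearMap.opNorm_le_of_re_inner_le ((norm_nonneg (matrixOperator (x k₀))).trans (hx k₀))
    fun ξ η hξ hη => ?_
  refine (Complex.re_le_norm _).trans ?_
  have hlim : Tendsto (fun k => inner ℂ (matrixOperator (x k) ξ) η) l
      (𝓝 (inner ℂ (matrixOperator y ξ) η)) := by
    simp only [inner_matrixOperator]
    exact tendsto_finsetSum _ fun i _ => tendsto_finsetSum _ fun j _ => hxy i j _ _
  refine le_of_tendsto hlim.norm (Eventually.of_forall fun k => ?_)
  calc ‖inner ℂ (matrixOperator (x k) ξ) η‖ ≤ ‖matrixOperator (x k) ξ‖ * ‖η‖ :=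
        norm_inner_le_norm _ _
    _ ≤ (‖matrixOperator (x k)‖ * ‖ξ‖) * ‖η‖ := by
        gcongr; exact ContinuousLinearMap.le_opNorm _ _
    _ ≤ C := by rw [hξ, hη, mul_one, mul_one]; exact hx k

end WeakLimits

/-! ### Compression and extension by zero are completely contractive -/

namespace HilbertProjection

variable {H : Type u} [NormedAddCommGroup H] [InnerProductSpace ℂ H] [CompleteSpace H]

theorem norm_proj_apply_le (q : HilbertProjection H) (v : H) : ‖q.proj v‖ ≤ ‖v‖ := by
  have h : inner ℂ (q.proj v) (q.proj v) = inner ℂ (q.proj v : H) v := by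
    rw [← q.adjoint_incl, ContinuousLinearMap.adjoint_inner_right]
    rfl
  have h₁ : ‖q.proj v‖ * ‖q.proj v‖ ≤ ‖q.proj v‖ * ‖v‖ := by
    have h₂ := norm_inner_le_norm (𝕜 := ℂ) (q.proj v : H) v
    rw [← h, inner_self_eq_norm_sq_to_K] at h₂
    simpa [pow_two] using h₂
  rcases (norm_nonneg (q.proj v)).eq_or_lt with h0 | h0
  · rw [← h0]; exact norm_nonneg v
  · exact le_of_mul_le_mul_left h₁ h0

theorem inner_extend (q : HilbertProjection H) (T : q.space →L[ℂ] q.space) (v w : H) :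
    inner ℂ (q.extend T v) w = inner ℂ (T (q.proj v)) (q.proj w) := by
  nth_rw 2 [← q.adjoint_incl]
  rw [ContinuousLinearMap.adjoint_inner_right]
  rfl

theorem inner_compress (q : HilbertProjection H) (x : H →L[ℂ] H) (v w : q.space) :
    inner ℂ (q.compress x v) w = inner ℂ (x (v : H)) (w : H) := by
  change inner ℂ (q.proj (x v)) w = _
  rw [← q.adjoint_incl, ContinuousLinearMap.adjoint_inner_left]
  rfl

/-- Coefficients of the extension at `ξ, η` are those of `T` at the coordinatewise projections,
which do not increase norms. -/
theorem norm_matrixOperator_extend_le (q : HilbertProjection H) {n : ℕ}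
    (T : Matrix (Fin n) (Fin n) (q.space →L[ℂ] q.space)) :
    ‖matrixOperator (Matrix.of fun i j => q.extend (T i j))‖ ≤ ‖matrixOperator T‖ := by
  have hproj : ∀ ξ : PiLp 2 (fun _ : Fin n => H),
      ‖(WithLp.toLp 2 fun i => q.proj (ξ i) : PiLp 2 (fun _ : Fin n => q.space))‖ ≤ ‖ξ‖ := by
    intro ξ
    rw [PiLp.norm_eq_of_L2, PiLp.norm_eq_of_L2]
    gcongr with i
    exact q.norm_proj_apply_le _
  refine ContinuousLinearMap.opNorm_le_of_re_inner_le (norm_nonneg (matrixOperator T)) fun ξ η hξ hη => ?_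
  refine (Complex.re_le_norm _).trans ?_
  have h : inner ℂ (matrixOperator (Matrix.of fun i j => q.extend (T i j)) ξ) η =
      inner ℂ (matrixOperator T (WithLp.toLp 2 fun i => q.proj (ξ i)))
        (WithLp.toLp 2 fun i => q.proj (η i) : PiLp 2 (fun _ : Fin n => q.space)) := by
    simp only [inner_matrixOperator, Matrix.of_apply, inner_extend]
  rw [h]
  refine (norm_inner_le_norm _ _).trans ?_
  have h₁ := ((matrixOperator T).le_opNorm _).trans
    (mul_le_mul_of_nonneg_left (hproj ξ) (norm_nonneg _))
  have h₂ := hproj η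
  rw [hξ, mul_one] at h₁
  rw [hη] at h₂
  simpa using mul_le_mul h₁ h₂ (norm_nonneg _) (norm_nonneg _)

theorem norm_matrixOperator_compress_le (q : HilbertProjection H) {n : ℕ}
    (x : Matrix (Fin n) (Fin n) (H →L[ℂ] H)) :
    ‖matrixOperator (Matrix.of fun i j => q.compress (x i j))‖ ≤ ‖matrixOperator x‖ := by
  have hincl : ∀ ξ : PiLp 2 (fun _ : Fin n => q.space),
      ‖(WithLp.toLp 2 fun i => (ξ i : H) : PiLp 2 (fun _ : Fin n => H))‖ = ‖ξ‖ := by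
    intro ξ
    rw [PiLp.norm_eq_of_L2, PiLp.norm_eq_of_L2]
    rfl
  refine ContinuousLinearMap.opNorm_le_of_re_inner_le (norm_nonneg (matrixOperator x)) fun ξ η hξ hη => ?_
  refine (Complex.re_le_norm _).trans ?_
  have h : inner ℂ (matrixOperator (Matrix.of fun i j => q.compress (x i j)) ξ) η =
      inner ℂ (matrixOperator x (WithLp.toLp 2 fun i => (ξ i : H)))
        (WithLp.toLp 2 fun i => (η i : H) : PiLp 2 (fun _ : Fin n => H)) := by
    simp only [inner_matrixOperator, Matrix.of_apply, inner_compress]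
  rw [h]
  refine (norm_inner_le_norm _ _).trans ?_
  have h₁ := (matrixOperator x).le_opNorm (WithLp.toLp 2 fun i => (ξ i : H))
  rw [hincl, hξ, mul_one] at h₁
  rwa [hincl, hη, mul_one]

end HilbertProjection

/-! ### Projections onto `M' D`, and `σ`-finiteness of their corners -/

namespace VonNeumannAlgebra

variable {H : Type u} [NormedAddCommGroup H] [InnerProductSpace ℂ H] [CompleteSpace H]

theorem commutant_apply_comm (M : VonNeumannAlgebra H) {x y : H →L[ℂ] H} (hx : x ∈ M)
    (hy : y ∈ M.commutant) (v : H) : x (y v) = y (x v) :=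
  congrArg (fun R : H →L[ℂ] H => R v) (mem_commutant_iff.1 hy x hx)

/-- A set of pairwise orthogonal projections, none of which annihilates a given vector, is
countable. -/
theorem countable_of_apply_ne_zero (S : Set (H →L[ℂ] H)) (hS : ∀ p ∈ S, IsStarProjection p)
    (horth : S.Pairwise fun p p' => p * p' = 0) (ξ : H) : {p ∈ S | p ξ ≠ 0}.Countable := by
  set A := {p ∈ S | p ξ ≠ 0}
  have hinner : ∀ p ∈ S, ∀ v w, inner ℂ (p v) w = inner ℂ v (p w) := fun p hp v w => by
    conv_lhs => rw [← (hS p hp).isSelfAdjoint.star_eq]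
    rw [ContinuousLinearMap.star_eq_adjoint, ContinuousLinearMap.adjoint_inner_left]
  let e : A → H := fun p => ((‖p.1 ξ‖ : ℂ)⁻¹) • p.1 ξ
  have he : Orthonormal ℂ e := by
    refine ⟨fun p => ?_, fun p p' hpp' => ?_⟩
    · simp [e, norm_smul, inv_mul_cancel₀ (norm_ne_zero_iff.2 p.2.2)]
    · have h0 : p.1 (p'.1 ξ) = 0 := congrArg (fun R : H →L[ℂ] H => R ξ)
        (horth p.2.1 p'.2.1 fun h => hpp' (Subtype.ext h))
      simp [e, inner_smul_left, inner_smul_right, hinner _ p.2.1, h0]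
  -- `⟨pξ, ξ⟩ = ‖pξ‖²`, so every Bessel coefficient of `ξ` is nonzero, while their squares are
  -- summable; hence the index set is countable.
  have hne : ∀ p : A, inner ℂ (e p) ξ ≠ 0 := by
    intro p
    have hidem : p.1 (p.1 ξ) = p.1 ξ := congrArg (fun R : H →L[ℂ] H => R ξ)
      (hS _ p.2.1).isIdempotentElem.eq
    have h : inner ℂ (p.1 ξ) ξ = inner ℂ (p.1 ξ) (p.1 ξ) := by
      rw [← hinner _ p.2.1, hidem]
    have hp : p.1 ξ ≠ 0 := p.2.2
    simp only [e, inner_smul_left, h]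
    exact mul_ne_zero (by simpa using hp) (inner_self_ne_zero.2 hp)
  have hsupp := (he.inner_products_summable (x := ξ)).countable_support
  have huniv : Function.support (fun p : A => ‖inner ℂ (e p) ξ‖ ^ 2) = Set.univ :=
    Set.eq_univ_of_forall fun p => pow_ne_zero 2 (norm_ne_zero_iff.2 (hne p))
  rw [huniv] at hsupp
  exact Set.countable_coe_iff.1 (Set.countable_univ_iff.1 hsupp)

/-- A von Neumann algebra with a countable separating set of vectors is `σ`-finite. -/
theorem isSigmaFinite_of_separating (M : VonNeumannAlgebra H) {D : Set H} (hD : D.Countable)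
    (hsep : ∀ x ∈ M, (∀ ξ ∈ D, x ξ = 0) → x = 0) : M.IsSigmaFinite := by
  intro S hS horth
  refine (hD.biUnion fun ξ _ =>
    countable_of_apply_ne_zero S (fun p hp => (hS p hp).2.1) horth ξ).mono fun p hp => ?_
  by_contra hcon
  refine (hS p hp).2.2 (hsep p (hS p hp).1 fun ξ hξ => ?_)
  by_contra hne
  exact hcon (Set.mem_biUnion hξ ⟨hp, hne⟩)

/-- The closed linear span of `M' D`. -/
def commutantSpan (M : VonNeumannAlgebra H) (D : Set H) : Submodule ℂ H :=
  (Submodule.span ℂ {v | ∃ y ∈ M.commutant, ∃ ξ ∈ D, y ξ = v}).topologicalClosure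

instance (M : VonNeumannAlgebra H) (D : Set H) : CompleteSpace (M.commutantSpan D) :=
  (Submodule.isClosed_topologicalClosure _).completeSpace_coe

/-- The projection onto the closed linear span of `M' D`. -/
noncomputable def commutantProjection (M : VonNeumannAlgebra H) (D : Set H) : HilbertProjection H where
  op := (M.commutantSpan D).starProjection
  isStarProjection := isStarProjection_starProjection

theorem commutantProjection_space (M : VonNeumannAlgebra H) (D : Set H) :
    (M.commutantProjection D).space = M.commutantSpan D :=
  Submodule.range_starProjection _

theorem subset_commutantSpan (M : VonNeumannAlgebra H) (D : Set H) :
    D ⊆ M.commutantSpan D := fun ξ hξ =>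
  Submodule.le_topologicalClosure _ (Submodule.subset_span ⟨1, one_mem _, ξ, hξ, rfl⟩)

theorem commutantProjection_apply (M : VonNeumannAlgebra H) (D : Set H) {ξ : H} (hξ : ξ ∈ D) :
    (M.commutantProjection D).op ξ = ξ :=
  Submodule.starProjection_eq_self_iff.2 (M.subset_commutantSpan D hξ)

/-- A projection lies in `M` once its range is invariant under `M'`. -/
theorem commutantProjection_mem (M : VonNeumannAlgebra H) (D : Set H) :
    (M.commutantProjection D).op ∈ M := by
  refine (IsStarProjection.mem_iff (M.commutantProjection D).isStarProjection M).2 fun y hy => ?_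
  have hr : (M.commutantProjection D).op.range = M.commutantSpan D :=
    M.commutantProjection_space D
  rw [hr, Module.End.mem_invtSubmodule]
  have hclosed : IsClosed ((M.commutantSpan D).comap (y : H →ₗ[ℂ] H) : Set H) :=
    (Submodule.isClosed_topologicalClosure _).preimage y.continuous
  refine Submodule.topologicalClosure_minimal _ (Submodule.span_le.2 ?_) hclosed
  rintro _ ⟨z, hz, ξ, hξ, rfl⟩
  exact Submodule.le_topologicalClosure _
    (Submodule.subset_span ⟨y * z, mul_mem hy hz, ξ, hξ, rfl⟩)

/-- The kernel of `x` is closed and invariant under `M'`, since `x` commutes with `M'`. -/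
theorem eq_zero_on_commutantSpan (M : VonNeumannAlgebra H) (D : Set H) {x : H →L[ℂ] H}
    (hx : x ∈ M) (h : ∀ ξ ∈ D, x ξ = 0) {v : H} (hv : v ∈ M.commutantSpan D) : x v = 0 := by
  have hclosed : IsClosed ((LinearMap.ker (x : H →ₗ[ℂ] H) : Submodule ℂ H) : Set H) :=
    isClosed_singleton.preimage x.continuous
  refine Submodule.topologicalClosure_minimal _ (Submodule.span_le.2 ?_) hclosed hv
  rintro _ ⟨y, hy, ξ, hξ, rfl⟩
  change x (y ξ) = 0
  rw [M.commutant_apply_comm hx hy, h ξ hξ, map_zero]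

theorem isSigmaFinite_corner_commutantProjection (M : VonNeumannAlgebra H) {D : Set H}
    (hD : D.Countable) :
    (M.corner (M.commutantProjection D) (M.commutantProjection_mem D)).IsSigmaFinite := by
  set q := M.commutantProjection D
  -- The vectors of `D`, regarded in `qH`, form the separating set.
  refine isSigmaFinite_of_separating _ (hD.image q.proj) fun T hT h0 => ?_
  have hzero : ∀ v : q.space, q.extend T (v : H) = 0 := fun v =>
    M.eq_zero_on_commutantSpan D hT
      (fun ξ hξ => by
        change q.incl (T (q.proj ξ)) = 0
        rw [h0 _ ⟨ξ, hξ, rfl⟩, map_zero])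
      (by rw [← M.commutantProjection_space D]; exact v.2)
  ext v
  have h := hzero v
  change q.incl (T (q.proj (q.incl v))) = 0 at h
  rw [q.proj_incl] at h
  exact h

/-- Weak limits of elements of a von Neumann algebra belong to it. -/
theorem mem_of_tendsto_inner (M : VonNeumannAlgebra H) {ι : Type*} {l : Filter ι} [l.NeBot]
    (T : ι → H →L[ℂ] H) (hT : ∀ i, T i ∈ M) (S : H →L[ℂ] H)
    (hS : ∀ v w, Tendsto (fun i => inner ℂ (T i v) w) l (𝓝 (inner ℂ (S v) w))) : S ∈ M := by
  rw [← M.commutant_commutant, mem_commutant_iff]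
  intro y hy
  ext v
  refine ext_inner_right ℂ fun w => ?_
  change inner ℂ (y (S v)) w = inner ℂ (S (y v)) w
  rw [← ContinuousLinearMap.adjoint_inner_right]
  refine tendsto_nhds_unique (hS v _) ((hS (y v) w).congr fun i => ?_)
  rw [M.commutant_apply_comm (hT i) hy, ← ContinuousLinearMap.adjoint_inner_right]

/-- The compression `x ↦ q x q`, as a map from `M` to its corner by `q`. -/
def compressCorner (M : VonNeumannAlgebra H) (q : HilbertProjection H) (hq : q.op ∈ M) :
    M.toStarSubalgebra →ₗ[ℂ] (M.corner q hq).toStarSubalgebra where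
  toFun x := ⟨q.compress x, (M.mem_corner_iff q hq _).2 ⟨x, x.2, rfl⟩⟩
  map_add' x y := by
    ext v
    simp [HilbertProjection.compress]
  map_smul' c x := by
    ext v
    simp [HilbertProjection.compress]

end VonNeumannAlgebra

/-! ### Passing from the corners to the whole inclusion -/

namespace VNInclusion

/-- A completely contractive projection of a corner, as a family of maps `big → small` on the
original Hilbert space. -/
theorem exists_linearMap_of_corner (I : VNInclusion.{u}) (q : HilbertProjection I.H)
    (hq : q.op ∈ I.small) (h : (I.corner q hq).HasCompletelyContractiveProjection) :
    ∃ T : I.big.toStarSubalgebra →ₗ[ℂ] (I.H →L[ℂ] I.H),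
      (∀ x, T x ∈ I.small) ∧
      (∀ x : I.big.toStarSubalgebra, (x : I.H →L[ℂ] I.H) ∈ I.small → T x = q.op * x * q.op) ∧
      ∀ (n : ℕ) (x : Matrix (Fin n) (Fin n) I.big.toStarSubalgebra),
        ‖matrixOperator (Matrix.of fun i j => T (x i j))‖ ≤
          ‖matrixOperator (Matrix.of fun i j => (x i j : I.H →L[ℂ] I.H))‖ := by
  obtain ⟨P, hP, hcc⟩ := h
  let E : (q.space →L[ℂ] q.space) →ₗ[ℂ] (I.H →L[ℂ] I.H) :=
    { toFun := q.extend
      map_add' := q.extend_add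
      map_smul' := fun c T => by ext v; simp [HilbertProjection.extend] }
  let R := (I.big.compressCorner q (I.le hq))
  let ι : (I.small.corner q hq).toStarSubalgebra →ₗ[ℂ] (q.space →L[ℂ] q.space) :=
    (I.small.corner q hq).toStarSubalgebra.subtype.toAlgHom.toLinearMap
  refine ⟨E ∘ₗ ι ∘ₗ P ∘ₗ R, fun x => (P (R x)).2, fun x hx => ?_, fun n x => ?_⟩
  · have h₁ := hP (R x) ((I.small.mem_corner_iff q hq _).2 ⟨x, hx, rfl⟩)
    change q.extend (P (R x)).1 = _
    exact (congrArg q.extend h₁).trans (q.extend_compress x)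
  · exact (q.norm_matrixOperator_extend_le _).trans
      ((hcc n (Matrix.of fun i j => R (x i j))).trans (q.norm_matrixOperator_compress_le _))

/-- If the corners by projections onto `M' D`, for all finite sets `D` of vectors, admit completely
contractive projections, then so does the inclusion: take a weak limit. -/
theorem hasCompletelyContractiveProjection_of_corners (I : VNInclusion.{u})
    (h : ∀ D : Finset I.H, (I.corner (I.small.commutantProjection D)
      (I.small.commutantProjection_mem D)).HasCompletelyContractiveProjection) :
    I.HasCompletelyContractiveProjection := by
  choose T hTmem hTsmall hTcc using fun D : Finset I.H =>
    I.exists_linearMap_of_corner _ _ (h D)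
  let U : Ultrafilter (Finset I.H) := Ultrafilter.of atTop
  have hlim : ∀ x : I.big.toStarSubalgebra, ∃ S : I.H →L[ℂ] I.H, ∀ v w,
      Tendsto (fun D => inner ℂ (T D x v) w) U (𝓝 (inner ℂ (S v) w)) := fun x =>
    exists_tendsto_inner_of_bounded U (fun D => T D x)
      ‖matrixOperator (Matrix.of fun _ _ : Fin 1 => (x : I.H →L[ℂ] I.H))‖ fun D v w => by
        refine (norm_inner_apply_le_matrixOperator (T D x) v w).trans ?_
        gcongr
        exact hTcc D 1 (Matrix.of fun _ _ => x)
  choose S hS using hlim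
  have hmem : ∀ x, S x ∈ I.small := fun x =>
    I.small.mem_of_tendsto_inner (fun D => T D x) (fun D => hTmem D x) (S x) (hS x)
  let P : I.big.toStarSubalgebra →ₗ[ℂ] I.small.toStarSubalgebra :=
    { toFun := fun x => ⟨S x, hmem x⟩
      map_add' := fun x y => by
        ext v
        refine ext_inner_right ℂ fun w => tendsto_nhds_unique (hS (x + y) v w) ?_
        simpa [inner_add_left] using (hS x v w).add (hS y v w)
      map_smul' := fun c x => by
        ext v
        refine ext_inner_right ℂ fun w => tendsto_nhds_unique (hS (c • x) v w) ?_
        simpa [inner_smul_left, mul_comm] using (hS x v w).const_mul (starRingEnd ℂ c) }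
  refine ⟨P, fun x hx => ?_, fun n x => ?_⟩
  · ext v
    refine ext_inner_right ℂ fun w => tendsto_nhds_unique (hS x v w) ?_
    classical
    -- Since `U` refines `atTop`, eventually `q` fixes both `v` and `w`, and the coefficient is
    -- constant from then on.
    have hev : ∀ᶠ D in (U : Filter (Finset I.H)), ({v, w} : Finset I.H) ≤ D :=
      (Ultrafilter.of_le atTop) (eventually_ge_atTop _)
    refine tendsto_const_nhds.congr' (hev.mono fun D hD => ?_)
    have hv := I.small.commutantProjection_apply D (ξ := v) (hD (by simp))
    have hw := I.small.commutantProjection_apply D (ξ := w) (hD (by simp))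
    set q := I.small.commutantProjection D
    change _ = inner ℂ (T D x v) w
    rw [hTsmall D x hx]
    change _ = inner ℂ (q.op (x.1 (q.op v))) w
    conv_rhs => rw [hv, ← q.isStarProjection.isSelfAdjoint.star_eq,
      ContinuousLinearMap.star_eq_adjoint, ContinuousLinearMap.adjoint_inner_left, hw]
  · exact norm_matrixOperator_le_of_tendsto (l := (U : Filter (Finset I.H)))
      (fun D => Matrix.of fun i j => T D (x i j)) _ (fun D => hTcc D n x)
      fun i j v w => hS (x i j) v w

end VNInclusion

end WeaklyConvergentProjections

theorem mainTheorem6 (𝓟 : VNInclusion.{u} → Prop)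
    (corner_stable : ∀ I : VNInclusion.{u}, 𝓟 I →
      ∀ (q : HilbertProjection I.H) (hq : q.op ∈ I.small), 𝓟 (I.corner q hq))
    (isomorphism_stable : ∀ I J : VNInclusion.{u}, I.Isomorphic J → 𝓟 I → 𝓟 J)
    (sigmaFinite_case : ∀ I : VNInclusion.{u}, 𝓟 I → I.small.IsSigmaFinite →
      I.HasCompletelyContractiveProjection) :
    ∀ I : VNInclusion.{u}, 𝓟 I → I.HasCompletelyContractiveProjection := fun I hI =>
  I.hasCompletelyContractiveProjection_of_corners fun D =>
    sigmaFinite_case _ (corner_stable I hI _ _)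
      (I.small.isSigmaFinite_corner_commutantProjection D.countable_toSet)
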